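/- Let $A=\mathbb{F}_2[x,y]/(y^2+y=x^3+x+1)$, let $K$ be its fraction field, and let $\deg a=-v_\infty(a)$ be the degree on $A$ at the unique place $\infty$ at infinity, so that $\deg x=2$, $\deg y=3$, $\deg(p(x)+q(x)y)=\max(2\deg p,\,2\deg q+3)$ and $\deg 0=-\infty$. Let $K\{\tau\}$ be the ring of twisted polynomials, $\tau c=c^2\tau$ for $c\in K$, acting by $\left(\sum_i c_i\tau^i\right)(f)=\sum_i c_i f^{2^i}$, and let $\rho\colon A\to K\{\tau\}$, $a\mapsto\rho_a$, be the rank one Drinfeld module (ring homomorphism) with $$\rho_x=x+(x^2+x)\tau+\tau^2,\qquad \rho_y=y+(y^2+y)\tau+x(y^2+y)\tau^2+\tau^3 .$$ Let $e(z)=\sum_{i\ge0} z^{2^i}/d_i$, with $d_0=1$, be its normalized exponential, i.e. the unique power series of this shape over $K$ with $e(az)=\rho_a(e(z))$ for all $a\in A$, and let $\log(z)=\sum_{i\ge0} z^{2^i}/\ell_i$ be its compositional inverse, $e(\log z)=z$. For $k\ge 0$ put $$p_k(w)=\sum_{j=0}^{k}\frac{w^{2^j}}{d_j\,\ell_{k-j}^{2^j}},\qquad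 e_k(w)=\prod_{a\in A,\ \deg a<k}(w+a),$$ and let $B_{k,i}$ be the coefficient of $w^{2^i}$ in $e_k(w)$. Then all $d_j$ and $\ell_j$ are well defined and nonzero (that is, all the coefficients $1/d_j$ of $e$ and $1/\ell_j$ of $\log$ are nonzero), and for every $k\ge2$ the polynomial $e_k$ divides $p_k$ in $K[w]$, and the quotient $R_k=p_k/e_k$ is $$R_k(w)=\frac{1}{d_k}\,e_k(w)+C,\qquad C=\frac{1}{d_{k-1}}+\frac{B_{k,k-2}^2}{d_k}.$$ Equivalently, $p_k(w)=\dfrac{e_k(w)^2}{d_k}+C\,e_k(w)$. -/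

import Mathlib

open Polynomial

noncomputable section

namespace DrinfeldExample

/-- The elliptic curve `y² + y = x³ + x + 1` over `𝔽₂`. -/
def curve : WeierstrassCurve.Affine (ZMod 2) := ⟨0, 0, 1, 1, 1⟩

/-- The ring `A = 𝔽₂[x, y] / (y² + y = x³ + x + 1)`. -/
abbrev A : Type := curve.CoordinateRing

/-- The fraction field of `A`. -/
abbrev K : Type := curve.FunctionField

/-- The element `x` of `A`. -/
def xA : A := WeierstrassCurve.Affine.CoordinateRing.mk curve (C X)

/-- The element `y` of `A`. -/
def yA : A := WeierstrassCurve.Affine.CoordinateRing.mk curve X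

/-- `x` as an element of the fraction field. -/
def xK : K := algebraMap A K xA

/-- `y` as an element of the fraction field. -/
def yK : K := algebraMap A K yA

/-- The degree `deg a = -v_∞(a)` on `A`, computed as the degree of the norm from `A` to `𝔽₂[x]`
(the place `∞` is the only one above that of `𝔽₂(x)`, with residue degree one).
Thus `deg 0 = ⊥`. -/
def deg (a : A) : WithBot ℕ := (Algebra.norm (ZMod 2)[X] a).degree

/-- Explicitly `deg (p(x) + q(x) y) = max (2 deg p) (2 deg q + 3)`. -/
theorem deg_eq (p q : (ZMod 2)[X]) :
    deg (p • (1 : A) + q • yA) = max (2 • p.degree) (2 • q.degree + 3) :=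
  WeierstrassCurve.Affine.CoordinateRing.degree_norm_smul_basis p q

theorem deg_xA : deg xA = 2 := by
  have h := deg_eq X 0
  have h1 : (X : (ZMod 2)[X]) • (1 : A) + (0 : (ZMod 2)[X]) • yA = xA := by
    rw [zero_smul, add_zero, WeierstrassCurve.Affine.CoordinateRing.smul, mul_one]; rfl
  rw [h1] at h
  rw [h]; simp

theorem deg_yA : deg yA = 3 := by
  have h := deg_eq 0 1
  rw [zero_smul, zero_add, one_smul] at h
  rw [h]; simp

theorem finite_deg_lt (k : ℕ) : {a : A | deg a < k}.Finite := by
  have hf : (Polynomial.degreeLT (ZMod 2) k : Set (ZMod 2)[X]).Finite := by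
    have : Finite (Polynomial.degreeLT (ZMod 2) k) :=
      Finite.of_equiv _ (Polynomial.degreeLTEquiv (ZMod 2) k).toEquiv.symm
    exact Set.toFinite _
  refine ((hf.prod hf).image
    (fun pq : (ZMod 2)[X] × (ZMod 2)[X] => pq.1 • (1 : A) + pq.2 • yA)).subset ?_
  intro a ha
  obtain ⟨p, q, rfl⟩ := WeierstrassCurve.Affine.CoordinateRing.exists_smul_basis_eq a
  have ha' : max (2 • p.degree) (2 • q.degree + 3) < (k : WithBot ℕ) := by
    rw [← deg_eq]; exact ha
  obtain ⟨h1, h2⟩ := max_lt_iff.mp ha'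
  refine ⟨(p, q), ⟨?_, ?_⟩, rfl⟩
  · rw [SetLike.mem_coe, Polynomial.mem_degreeLT]
    induction hp : p.degree with
    | bot => exact WithBot.bot_lt_coe k
    | coe n =>
      rw [hp] at h1
      rw [two_nsmul] at h1
      have h1' : n + n < k := WithBot.coe_lt_coe.mp h1
      have : n < k := by omega
      exact WithBot.coe_lt_coe.mpr this
  · rw [SetLike.mem_coe, Polynomial.mem_degreeLT]
    induction hq : q.degree with
    | bot => exact WithBot.bot_lt_coe k
    | coe n =>
      rw [hq] at h2
      rw [two_nsmul] at h2
      have h2' : n + n + 3 < k := WithBot.coe_lt_coe.mp h2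
      have : n < k := by omega
      exact WithBot.coe_lt_coe.mpr this

/-- `A_{<k} = {a ∈ A : deg a < k}`. -/
def Alt (k : ℕ) : Finset A := (finite_deg_lt k).toFinset

/-- `e_k(w) = ∏_{deg a < k} (w + a)`. -/
def ePoly (k : ℕ) : K[X] := ∏ a ∈ Alt k, (X + C (algebraMap A K a))

/-- `B_{k,i}`, the coefficient of `w^(2^i)` in `e_k(w)`. -/
def B (k i : ℕ) : K := (ePoly k).coeff (2 ^ i)

theorem curve_eq : yK ^ 2 + yK = xK ^ 3 + xK + 1 := by
  have h : yA ^ 2 + yA = xA ^ 3 + xA + 1 := by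
    have h0 : WeierstrassCurve.Affine.CoordinateRing.mk curve curve.polynomial = 0 :=
      AdjoinRoot.mk_self
    simp only [WeierstrassCurve.Affine.polynomial, curve, map_add, map_pow, map_one, map_zero, zero_mul, zero_add,
      one_mul, add_zero] at h0
    exact sub_eq_zero.mp h0
  have := congrArg (algebraMap A K) h
  simpa [xK, yK] using this

instance : CharP K 2 := charP_of_injective_algebraMap (algebraMap (ZMod 2) K).injective 2

instance : CharP (PowerSeries K) 2 :=
  charP_of_injective_algebraMap (algebraMap K (PowerSeries K)).injective 2

/-- The ring of `𝔽₂`-linear endomorphisms of `K⟦z⟧` under composition. A twisted polynomial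
`∑ cᵢ τⁱ` over `K` is identified with the endomorphism `f ↦ ∑ cᵢ f^(2^i)`; this identification is
faithful, and composition is governed by `τ c = c² τ`. -/
abbrev TwistedEnd : Type := Module.End (ZMod 2) (PowerSeries K)

/-- Multiplication by a constant `c ∈ K`. -/
def scalar (c : K) : TwistedEnd := LinearMap.mulLeft (ZMod 2) (PowerSeries.C c)

/-- The Frobenius `τ : f ↦ f²`. -/
def τ : TwistedEnd := (FiniteField.frobeniusAlgHom (ZMod 2) (PowerSeries K)).toLinearMap

@[simp] theorem scalar_apply (c : K) (f : PowerSeries K) : scalar c f = PowerSeries.C c * f := rfl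

@[simp] theorem τ_apply (f : PowerSeries K) : τ f = f ^ 2 := by simp [τ]

theorem τ_mul_scalar (c : K) : τ * scalar c = scalar (c ^ 2) * τ := by
  ext1 f; simp [mul_pow]

/-- `ρ_x = x + (x² + x) τ + τ²`. -/
def rhoX : TwistedEnd := scalar xK + scalar (xK ^ 2 + xK) * τ + τ ^ 2

/-- `ρ_y = y + (y² + y) τ + x (y² + y) τ² + τ³`. -/
def rhoY : TwistedEnd :=
  scalar yK + scalar (yK ^ 2 + yK) * τ + scalar (xK * (yK ^ 2 + yK)) * τ ^ 2 + τ ^ 3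

theorem rhoX_apply (f : PowerSeries K) : rhoX f =
    PowerSeries.C xK * f + PowerSeries.C (xK ^ 2 + xK) * f ^ 2 + f ^ 4 := by
  simp only [rhoX, pow_two τ, LinearMap.add_apply, Module.End.mul_apply, scalar_apply, τ_apply]
  ring

theorem rhoY_apply (f : PowerSeries K) : rhoY f =
    PowerSeries.C yK * f + PowerSeries.C (yK ^ 2 + yK) * f ^ 2
      + PowerSeries.C (xK * (yK ^ 2 + yK)) * f ^ 4 + f ^ 8 := by
  simp only [rhoY, pow_succ τ, pow_zero, one_mul, LinearMap.add_apply, Module.End.mul_apply,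
    scalar_apply, τ_apply]
  ring

theorem comm_aux {R : Type*} [CommRing R] [CharP R 2] (x y f g h : R) (hy : y ^ 2 = y + (x ^ 3 + x + 1))
   (hg : g = y * f + (y^2+y) * f^2 + x*(y^2+y)*f^4 + f^8)
   (hh : h = x * f + (x^2+x) * f^2 + f^4) :
   x * g + (x^2+x) * g^2 + g^4 = y * h + (y^2+y) * h^2 + x*(y^2+y)*h^4 + h^8 := by
  have h2 : (2:R) = 0 := CharTwo.two_eq_zero
  have hv : y^2 + y = x^3+x+1 := by linear_combination hy + y * h2
  have y4 : y ^ 4 = y + (x^3+x+1) + (x^6+x^2+1) := by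
    have : y^4 = (y^2)^2 := by ring
    rw [this, hy, CharTwo.add_sq, CharTwo.add_sq, CharTwo.add_sq, hy]; ring
  rw [hv] at hg ⊢
  have g2 : g^2 = y^2 * f^2 + (x^6+x^2+1) * f^4 + x^2*(x^6+x^2+1)*f^8 + f^16 := by
    rw [hg]; simp only [CharTwo.add_sq, mul_pow]; ring
  have g4 : g^4 = y^4 * f^4 + (x^12+x^4+1) * f^8 + x^4*(x^12+x^4+1)*f^16 + f^32 := by
    rw [show g^4 = (g^2)^2 by ring, g2]; simp only [CharTwo.add_sq, mul_pow]; ring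
  have e2 : h^2 = x^2 * f^2 + (x^4+x^2) * f^4 + f^8 := by
    rw [hh]; simp only [CharTwo.add_sq, mul_pow]; ring
  have e4 : h^4 = x^4 * f^4 + (x^8+x^4) * f^8 + f^16 := by
    rw [show h^4 = (h^2)^2 by ring, e2]; simp only [CharTwo.add_sq, mul_pow]; ring
  have e8 : h^8 = x^8 * f^8 + (x^16+x^8) * f^16 + f^32 := by
    rw [show h^8 = (h^4)^2 by ring, e4]; simp only [CharTwo.add_sq, mul_pow]; ring
  rw [g4, g2, e8, e4, e2, hg, hh, y4, hy]
  rw [← sub_eq_zero]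
  ring_nf
  simp [h2]

theorem rel_aux {R : Type*} [CommRing R] [CharP R 2] (x y f g h k : R) (hy : y ^ 2 = y + (x ^ 3 + x + 1))
   (hg : g = y * f + (y^2+y) * f^2 + x*(y^2+y)*f^4 + f^8)
   (hh : h = x * f + (x^2+x) * f^2 + f^4) (hk : k = x * h + (x^2+x) * h^2 + h^4) :
   (y * g + (y^2+y) * g^2 + x*(y^2+y)*g^4 + g^8) + g = (x * k + (x^2+x) * k^2 + k^4) + h + f := by
  have h2 : (2:R) = 0 := CharTwo.two_eq_zero
  have hv : y^2 + y = x^3+x+1 := by linear_combination hy + y * h2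
  have y4 : y ^ 4 = y + (x^3+x+1) + (x^6+x^2+1) := by
    have : y^4 = (y^2)^2 := by ring
    rw [this, hy, CharTwo.add_sq, CharTwo.add_sq, CharTwo.add_sq, hy]; ring
  have y8 : y ^ 8 = y + (x^3+x+1) + (x^6+x^2+1) + (x^12+x^4+1):= by
    have : y^8 = (y^4)^2 := by ring
    rw [this, y4]; simp only [CharTwo.add_sq, hy]; ring
  rw [hv] at hg ⊢
  have g2 : g^2 = y^2 * f^2 + (x^6+x^2+1) * f^4 + x^2*(x^6+x^2+1)*f^8 + f^16 := by
    rw [hg]; simp only [CharTwo.add_sq, mul_pow]; ring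
  have g4 : g^4 = y^4 * f^4 + (x^12+x^4+1) * f^8 + x^4*(x^12+x^4+1)*f^16 + f^32 := by
    rw [show g^4 = (g^2)^2 by ring, g2]; simp only [CharTwo.add_sq, mul_pow]; ring
  have g8 : g^8 = y^8 * f^8 + (x^24+x^8+1) * f^16 + x^8*(x^24+x^8+1)*f^32 + f^64 := by
    rw [show g^8 = (g^4)^2 by ring, g4]; simp only [CharTwo.add_sq, mul_pow]; ring
  have e2 : h^2 = x^2 * f^2 + (x^4+x^2) * f^4 + f^8 := by
    rw [hh]; simp only [CharTwo.add_sq, mul_pow]; ring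
  have e4 : h^4 = x^4 * f^4 + (x^8+x^4) * f^8 + f^16 := by
    rw [show h^4 = (h^2)^2 by ring, e2]; simp only [CharTwo.add_sq, mul_pow]; ring
  have e8 : h^8 = x^8 * f^8 + (x^16+x^8) * f^16 + f^32 := by
    rw [show h^8 = (h^4)^2 by ring, e4]; simp only [CharTwo.add_sq, mul_pow]; ring
  have e16 : h^16 = x^16 * f^16 + (x^32+x^16) * f^32 + f^64 := by
    rw [show h^16 = (h^8)^2 by ring, e8]; simp only [CharTwo.add_sq, mul_pow]; ring
  have k2 : k^2 = x^2 * h^2 + (x^4+x^2) * h^4 + h^8 := by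
    rw [hk]; simp only [CharTwo.add_sq, mul_pow]; ring
  have k4 : k^4 = x^4 * h^4 + (x^8+x^4) * h^8 + h^16 := by
    rw [show k^4 = (k^2)^2 by ring, k2]; simp only [CharTwo.add_sq, mul_pow]; ring
  rw [k4, k2, hk, e16, g8, g4, g2, e8, e4, e2, hg, hh, y8, y4]
  have : y * (y * f) = y^2 * f := by ring
  rw [← sub_eq_zero]
  simp only [mul_add, this, hy]
  ring_nf
  simp [h2, show (4 : R) = 2 * 2 by norm_num]

theorem curve_eq_series : (PowerSeries.C yK : PowerSeries K) ^ 2 = PowerSeries.C yK +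
    ((PowerSeries.C xK) ^ 3 + PowerSeries.C xK + 1) := by
  have h2 : (2 : K) = 0 := CharTwo.two_eq_zero
  have h : yK ^ 2 = yK + (xK ^ 3 + xK + 1) := by linear_combination curve_eq - yK * h2
  simpa using congrArg (PowerSeries.C : K →+* PowerSeries K) h

theorem rho_commute : Commute rhoX rhoY := by
  refine LinearMap.ext fun f => ?_
  simp only [Module.End.mul_apply]
  rw [rhoX_apply (rhoY f), rhoY_apply (rhoX f)]
  simp only [map_add, map_mul, map_pow]
  refine comm_aux _ _ f _ _ curve_eq_series ?_ ?_
  · rw [rhoY_apply]; simp only [map_add, map_mul, map_pow]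
  · rw [rhoX_apply]; simp only [map_add, map_pow]

theorem rho_relation : rhoY ^ 2 + rhoY = rhoX ^ 3 + rhoX + 1 := by
  refine LinearMap.ext fun f => ?_
  simp only [pow_succ, pow_zero, one_mul, LinearMap.add_apply, Module.End.mul_apply,
    Module.End.one_apply]
  rw [rhoX_apply (rhoX (rhoX f)), rhoY_apply (rhoY f)]
  simp only [map_add, map_mul, map_pow]
  refine rel_aux _ _ f _ _ _ curve_eq_series ?_ ?_ ?_
  · rw [rhoY_apply]; simp only [map_add, map_mul, map_pow]
  · rw [rhoX_apply]; simp only [map_add, map_pow]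
  · rw [rhoX_apply (rhoX f)]; simp only [map_add, map_pow]

theorem commute_aeval (p : (ZMod 2)[X]) : Commute (aeval rhoX p) rhoY := by
  induction p using Polynomial.induction_on' with
  | add p q hp hq => rw [map_add]; exact hp.add_left hq
  | monomial n c =>
    rw [aeval_monomial]
    exact Commute.mul_left (Algebra.commutes c rhoY) (rho_commute.pow_left n)

/-- The ring homomorphism `𝔽₂[x][y] → K{τ}` with `x ↦ ρ_x`, `y ↦ ρ_y`. -/
def rhoFree : (ZMod 2)[X][X] →+* TwistedEnd :=
  eval₂RingHom' (aeval rhoX : (ZMod 2)[X] →ₐ[ZMod 2] TwistedEnd).toRingHom rhoY commute_aeval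

theorem rhoFree_CX : rhoFree (C X) = rhoX := by
  change eval₂ _ rhoY (C X) = _
  rw [eval₂_C]
  exact aeval_X rhoX

theorem rhoFree_X : rhoFree X = rhoY := eval₂_X _ _

theorem rhoFree_polynomial : rhoFree curve.polynomial = 0 := by
  have h : curve.polynomial = X ^ 2 + X - ((C X) ^ 3 + C X + 1) := by
    simp [WeierstrassCurve.Affine.polynomial, curve]
  refine (congrArg rhoFree h).trans ?_
  simp only [map_sub, map_add, map_pow, map_one, rhoFree_CX, rhoFree_X]
  exact sub_eq_zero.mpr rho_relation

/-- The Drinfeld module `ρ : A → K{τ}`: the ring homomorphism with `ρ(x) = ρ_x`, `ρ(y) = ρ_y`. -/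
def rho : A →+* TwistedEnd :=
  Ideal.Quotient.lift (Ideal.span {curve.polynomial}) rhoFree (by
    intro a ha
    obtain ⟨b, rfl⟩ := Ideal.mem_span_singleton'.mp ha
    rw [map_mul, rhoFree_polynomial, mul_zero])

theorem rho_xA : rho xA = rhoX := rhoFree_CX

theorem rho_yA : rho yA = rhoY := rhoFree_X

/-- `e` is the normalized exponential of `ρ`: it has the shape `e(z) = z + ∑_{i ≥ 1} aᵢ z^(2^i)`,
and `e(a z) = ρ_a(e(z))` for all `a ∈ A`. -/
structure IsExponential (e : PowerSeries K) : Prop where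
  coeff_eq_zero : ∀ n : ℕ, (∀ i : ℕ, n ≠ 2 ^ i) → PowerSeries.coeff n e = 0
  coeff_one : PowerSeries.coeff 1 e = 1
  functional : ∀ a : A, PowerSeries.rescale (algebraMap A K a) e = rho a e

theorem xK_pow_ne {n : ℕ} (hn : 2 ≤ n) : xK ^ n - xK ≠ 0 := by
  intro h
  have h1 : (algebraMap (ZMod 2)[X] A) (X ^ n - X) = 0 := by
    have h2 : algebraMap A K ((algebraMap (ZMod 2)[X] A) (X ^ n - X)) = 0 := by
      rw [map_sub, map_pow, map_sub, map_pow]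
      exact h
    exact (map_eq_zero_iff _ (IsFractionRing.injective A K)).mp h2
  have h3 : (X ^ n - X : (ZMod 2)[X]) = 0 :=
    (map_eq_zero_iff _ (FaithfulSMul.algebraMap_injective (ZMod 2)[X] A)).mp h1
  have h4 := congrArg (fun p : (ZMod 2)[X] => p.coeff 1) h3
  simp [coeff_X_pow, show ¬ (1 = n) by omega] at h4

theorem eq_zero_of_functional (h : PowerSeries K) (h0 : PowerSeries.coeff 0 h = 0)
    (h1 : PowerSeries.coeff 1 h = 0) (hx : PowerSeries.rescale xK h = rhoX h) : h = 0 := by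
  ext n
  rw [map_zero]
  induction n using Nat.strong_induction_on with
  | _ n ih =>
    rcases Nat.lt_or_ge n 2 with hn | hn
    · interval_cases n <;> assumption
    · obtain ⟨g, rfl⟩ : PowerSeries.X ^ n ∣ h := PowerSeries.X_pow_dvd_iff.mpr ih
      have hz : ∀ m : ℕ, 2 ≤ m →
          PowerSeries.coeff n ((PowerSeries.X ^ n * g) ^ m) = 0 := by
        intro m hm
        rw [mul_pow, ← pow_mul]
        refine PowerSeries.coeff_of_lt_order _ ?_
        refine lt_of_lt_of_le ?_ (PowerSeries.le_order_mul _ _)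
        rw [PowerSeries.order_X_pow]
        refine lt_of_lt_of_le ?_ le_self_add
        have : n < n * m := by nlinarith
        exact_mod_cast this
      have hc := congrArg (PowerSeries.coeff n) hx
      rw [rhoX_apply, PowerSeries.coeff_rescale, map_add, map_add, PowerSeries.coeff_C_mul,
        PowerSeries.coeff_C_mul, hz 2 le_rfl, hz 4 (by norm_num), mul_zero, add_zero,
        add_zero] at hc
      have : (xK ^ n - xK) * PowerSeries.coeff n (PowerSeries.X ^ n * g) = 0 := by
        linear_combination hc
      exact (mul_eq_zero.mp this).resolve_left (xK_pow_ne hn)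

theorem coeff_sq (f : PowerSeries K) (n : ℕ) : PowerSeries.coeff n (f ^ 2) =
    if 2 ∣ n then (PowerSeries.coeff (n / 2) f) ^ 2 else 0 := by
  have h : (f.expand 2 two_ne_zero).map (frobenius K 2) = f ^ 2 :=
    MvPowerSeries.map_frobenius_expand 2 two_ne_zero
  rw [← h, PowerSeries.coeff_map, PowerSeries.coeff_expand]
  split_ifs <;> simp [frobenius_def]

/-- The coefficients of the exponential, obtained by comparing coefficients in
`e(x z) = ρ_x(e(z))`. -/
def expFun : ℕ → K
  | 0 => 0
  | 1 => 1
  | (n + 2) =>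
    ((xK ^ 2 + xK) * (if 2 ∣ n + 2 then expFun ((n + 2) / 2) ^ 2 else 0)
      + (if 2 ∣ n + 2 then
          (if 2 ∣ (n + 2) / 2 then expFun ((n + 2) / 2 / 2) ^ 2 else 0) ^ 2 else 0))
      / (xK ^ (n + 2) - xK)
  decreasing_by all_goals omega

theorem expFun_functional_x :
    PowerSeries.rescale xK (PowerSeries.mk expFun) = rhoX (PowerSeries.mk expFun) := by
  ext n
  rw [rhoX_apply, show (PowerSeries.mk expFun) ^ 4 = ((PowerSeries.mk expFun) ^ 2) ^ 2 by ring,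
    PowerSeries.coeff_rescale, map_add, map_add, PowerSeries.coeff_C_mul, PowerSeries.coeff_C_mul,
    coeff_sq, coeff_sq, coeff_sq]
  simp only [PowerSeries.coeff_mk]
  match n with
  | 0 => simp [expFun]
  | 1 => simp [expFun]
  | n + 2 =>
    have h := xK_pow_ne (n := n + 2) (by omega)
    have h' : expFun (n + 2) * (xK ^ (n + 2) - xK) =
      (xK ^ 2 + xK) * (if 2 ∣ n + 2 then expFun ((n + 2) / 2) ^ 2 else 0)
      + (if 2 ∣ n + 2 then
          (if 2 ∣ (n + 2) / 2 then expFun ((n + 2) / 2 / 2) ^ 2 else 0) ^ 2 else 0) := by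
      rw [expFun, div_mul_cancel₀ _ h]
    linear_combination h'

theorem expFun_eq_zero (n : ℕ) (hn : ∀ i : ℕ, n ≠ 2 ^ i) : expFun n = 0 := by
  induction n using Nat.strong_induction_on with
  | _ n ih =>
    match n with
    | 0 => simp [expFun]
    | 1 => exact absurd rfl (hn 0)
    | n + 2 =>
      have key : 2 ∣ n + 2 → ∀ i : ℕ, (n + 2) / 2 ≠ 2 ^ i := fun hd i hi =>
        hn (i + 1) (by rw [pow_succ]; omega)
      have key2 : 2 ∣ n + 2 → 2 ∣ (n + 2) / 2 → ∀ i : ℕ, (n + 2) / 2 / 2 ≠ 2 ^ i :=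
        fun hd hd' i hi => key hd (i + 1) (by rw [pow_succ]; omega)
      rw [expFun]
      by_cases hd : 2 ∣ n + 2
      · rw [ih _ (by omega) (key hd)]
        by_cases hd' : 2 ∣ (n + 2) / 2
        · rw [ih _ (by omega) (key2 hd hd')]; simp
        · rw [if_neg hd']; simp
      · simp [hd]

theorem A_induction {P : A → Prop} (zero : P 0) (one : P 1) (x : P xA) (y : P yA)
    (add : ∀ a b, P a → P b → P (a + b)) (mul : ∀ a b, P a → P b → P (a * b)) (a : A) : P a := by
  have hp : ∀ p : (ZMod 2)[X], P (algebraMap (ZMod 2)[X] A p) := by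
    intro p
    induction p using Polynomial.induction_on with
    | C c =>
      have hc : ∀ b : ZMod 2, b = 0 ∨ b = 1 := by decide
      rcases hc c with rfl | rfl
      · rw [map_zero, map_zero]; exact zero
      · rw [map_one, map_one]; exact one
    | add p q hp hq => rw [map_add]; exact add _ _ hp hq
    | monomial n c h =>
      rw [pow_succ, ← mul_assoc, map_mul]
      exact mul _ _ h x
  obtain ⟨p, q, rfl⟩ := WeierstrassCurve.Affine.CoordinateRing.exists_smul_basis_eq a
  rw [Algebra.smul_def, Algebra.smul_def, mul_one]
  exact add _ _ (hp p) (mul _ _ (hp q) y)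

theorem rescale_C (c b : K) : PowerSeries.rescale c (PowerSeries.C b) = PowerSeries.C b := by
  ext n
  rw [PowerSeries.coeff_rescale, PowerSeries.coeff_C]
  split_ifs with h <;> simp [h]

theorem rescale_rho (a : A) : ∀ (c : K) (f : PowerSeries K),
    PowerSeries.rescale c (rho a f) = rho a (PowerSeries.rescale c f) := by
  induction a using A_induction with
  | zero => intro c f; simp
  | one => intro c f; simp
  | x =>
    intro c f
    rw [rho_xA, rhoX_apply, rhoX_apply]
    simp only [map_add, map_mul, map_pow, rescale_C]
  | y =>
    intro c f
    rw [rho_yA, rhoY_apply, rhoY_apply]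
    simp only [map_add, map_mul, map_pow, rescale_C]
  | add a b ha hb => intro c f; simp [ha, hb]
  | mul a b ha hb => intro c f; simp [ha, hb]

theorem rescale_add_of_additive (e : PowerSeries K)
    (h : ∀ n : ℕ, (∀ i : ℕ, n ≠ 2 ^ i) → PowerSeries.coeff n e = 0) (a b : K) :
    PowerSeries.rescale (a + b) e = PowerSeries.rescale a e + PowerSeries.rescale b e := by
  ext n
  rw [map_add, PowerSeries.coeff_rescale, PowerSeries.coeff_rescale, PowerSeries.coeff_rescale]
  by_cases hn : ∀ i : ℕ, n ≠ 2 ^ i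
  · rw [h n hn]; simp
  · push Not at hn
    obtain ⟨i, rfl⟩ := hn
    rw [add_pow_char_pow, add_mul]

/-- An additive solution of the functional equation for `x` satisfies it for all of `A`. -/
theorem functional_of_x (e : PowerSeries K)
    (h : ∀ n : ℕ, (∀ i : ℕ, n ≠ 2 ^ i) → PowerSeries.coeff n e = 0)
    (hx : PowerSeries.rescale xK e = rhoX e) (a : A) :
    PowerSeries.rescale (algebraMap A K a) e = rho a e := by
  have h0 : PowerSeries.coeff 0 e = 0 := h 0 fun i => (pow_pos two_pos i).ne
  induction a using A_induction with
  | zero =>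
    rw [map_zero, map_zero, PowerSeries.rescale_zero_apply,
      ← PowerSeries.coeff_zero_eq_constantCoeff_apply, h0]
    simp
  | one => simp
  | x => rw [rho_xA]; exact hx
  | y =>
    change PowerSeries.rescale yK e = _
    rw [← sub_eq_zero]
    refine eq_zero_of_functional _ ?_ ?_ ?_
    · rw [rho_yA, rhoY_apply]
      have h0' : PowerSeries.constantCoeff (PowerSeries.rescale yK e) = 0 := by
        rw [← PowerSeries.coeff_zero_eq_constantCoeff_apply, PowerSeries.coeff_rescale, h0,
          mul_zero]
      simp at h0
      simp [h0, h0']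
    · obtain ⟨g, rfl⟩ : PowerSeries.X ∣ e := PowerSeries.X_dvd_iff.mpr (by simpa using h0)
      have hz : ∀ m : ℕ, 2 ≤ m → PowerSeries.coeff 1 ((PowerSeries.X * g) ^ m) = 0 := by
        intro m hm
        rw [mul_pow, PowerSeries.coeff_X_pow_mul', if_neg (by omega)]
      rw [rho_yA, rhoY_apply]
      rw [map_sub, map_add, map_add, map_add, PowerSeries.coeff_rescale, PowerSeries.coeff_C_mul,
        PowerSeries.coeff_C_mul, PowerSeries.coeff_C_mul]
      rw [hz 8 (by norm_num), hz 4 (by norm_num), hz 2 le_rfl]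
      ring
    · have e1 : PowerSeries.rescale xK (PowerSeries.rescale yK e) =
          rhoX (PowerSeries.rescale yK e) := by
        rw [PowerSeries.rescale_rescale, mul_comm, ← PowerSeries.rescale_rescale, hx, ← rho_xA,
          rescale_rho]
      have e2 : PowerSeries.rescale xK (rho yA e) = rhoX (rho yA e) := by
        rw [rescale_rho, hx, ← rho_xA, ← Module.End.mul_apply, ← Module.End.mul_apply, ← map_mul,
          ← map_mul, mul_comm]
      rw [map_sub, map_sub, e1, e2]
  | add a b ha hb =>
    rw [map_add, map_add, rescale_add_of_additive e h, ha, hb, LinearMap.add_apply]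
  | mul a b ha hb =>
    rw [map_mul, map_mul, mul_comm, ← PowerSeries.rescale_rescale, hb, rescale_rho, ha,
      ← Module.End.mul_apply, ← map_mul, ← map_mul, mul_comm]

theorem existsUnique_exponential : ∃! e : PowerSeries K, IsExponential e := by
  have z0 : ∀ i : ℕ, 0 ≠ 2 ^ i := fun i => (pow_pos two_pos i).ne
  have hs : ∀ n : ℕ, (∀ i : ℕ, n ≠ 2 ^ i) → PowerSeries.coeff n (PowerSeries.mk expFun) = 0 :=
    fun n hn => by rw [PowerSeries.coeff_mk, expFun_eq_zero n hn]
  refine ⟨PowerSeries.mk expFun, ⟨hs, by simp [expFun], functional_of_x _ hs expFun_functional_x⟩, ?_⟩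
  · intro e he
    rw [← sub_eq_zero]
    refine eq_zero_of_functional _ ?_ ?_ ?_
    · rw [map_sub, he.coeff_eq_zero 0 z0]; simp [expFun]
    · rw [map_sub, he.coeff_one]; simp [expFun]
    · rw [map_sub, map_sub, expFun_functional_x, ← rho_xA, ← he.functional xA]; rfl

/-- The normalized exponential `e(z) = ∑ z^(2^i) / dᵢ` of `ρ`: the unique power series with
`IsExponential`. -/
def expSeries : PowerSeries K := existsUnique_exponential.choose

theorem isExponential_expSeries : IsExponential expSeries := existsUnique_exponential.choose_spec.1

theorem isUnit_coeff_one_expSeries : IsUnit (PowerSeries.coeff 1 expSeries) := by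
  rw [isExponential_expSeries.coeff_one]; exact isUnit_one

/-- The logarithm `log(z) = ∑ z^(2^i) / ℓᵢ`: the compositional inverse of the exponential. -/
def logSeries : PowerSeries K := expSeries.substInvOfIsUnit isUnit_coeff_one_expSeries

theorem exp_log : expSeries.subst logSeries = (PowerSeries.X : PowerSeries K) :=
  expSeries.subst_substInvOfIsUnit_right
    (by
      rw [← PowerSeries.coeff_zero_eq_constantCoeff_apply]
      exact isExponential_expSeries.coeff_eq_zero 0 fun i => (pow_pos two_pos i).ne)
    isUnit_coeff_one_expSeries

/-- `dᵢ`, where `1 / dᵢ` is the coefficient of `z^(2^i)` in the exponential. -/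
def d (i : ℕ) : K := (PowerSeries.coeff (2 ^ i) expSeries)⁻¹

/-- `ℓᵢ`, where `1 / ℓᵢ` is the coefficient of `z^(2^i)` in the logarithm. -/
def ell (i : ℕ) : K := (PowerSeries.coeff (2 ^ i) logSeries)⁻¹

/-- `p_k(w) = ∑_{j ≤ k} w^(2^j) / (d_j ℓ_{k-j}^(2^j))`. -/
def pPoly (k : ℕ) : K[X] :=
  ∑ j ∈ Finset.range (k + 1), C (1 / (d j * ell (k - j) ^ 2 ^ j)) * X ^ 2 ^ j

/-- `R_k(w) = p_k(w) / e_k(w)`, a priori a rational function of `w`. -/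
def R (k : ℕ) : RatFunc K :=
  algebraMap K[X] (RatFunc K) (pPoly k) / algebraMap K[X] (RatFunc K) (ePoly k)

/-- The constant `C = 1 / d_{k-1} + B_{k,k-2}² / d_k`, for `k ≥ 2`. -/
def constC (k : ℕ) : K := 1 / d (k - 1) + B k (k - 2) ^ 2 / d k

end DrinfeldExample

end

/-! The value $p_k(w)$ is the coefficient of $z^{2^k}$ in $e(w\log z)$. For $a\in A$ the functional
equation gives $e(a\log z)=\rho_a(e(\log z))=\rho_a(z)$, a polynomial of degree $\deg a$ in $\tau$.
Hence $p_k(a)=0$ whenever $\deg a<k$ (`pSeq_eq_zero`), so $p_k$ vanishes on all roots of $e_k$.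

There is no element of degree 1 in $A$ and, up to lower terms, exactly one of each degree $\ge2$, so
$A_{<k}$ has $2^{k-1}$ elements for $k\ge2$. Moreover $e_k$ is a linearized monic polynomial of
degree $2^{k-1}$ (`ePoly_eq_linPoly`). Thus $p_k$, $e_k^2/d_k$ and $Ce_k$ are all linearized, of
degree at most $2^k$. In $p_k-e_k^2/d_k-Ce_k$ the coefficient of $w^{2^k}$ cancels because
$\ell_0=1$, and that of $w^{2^{k-1}}$ cancels by the choice of $C$, because $\ell_1=1$. What remains
has degree at most $2^{k-2}$ and $2^{k-1}$ roots, so it is zero (`pPoly_eq`).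

Additive series are handled as twisted power series in $\tau$, stored as coefficient sequences. The
logarithm is built from the recursion forced by $x\log=\log\rho_x$ and then identified with the
compositional inverse (`logSeries_eq`). The same kind of recursion for $e$ and $\log$ makes every
coefficient a quotient of monic polynomials in $\mathbb{F}_2[x]$, hence nonzero. -/

namespace DrinfeldExample

/-! ### Twisted power series as coefficient sequences -/

section Skew

variable {R : Type*} [CommRing R]

/-- The product `(∑ aᵢ τⁱ) (∑ bⱼ τʲ)` of twisted power series with `τ c = c² τ`, on sequences of
coefficients. -/
def skewMul (a b : ℕ → R) (n : ℕ) : R :=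
  ∑ ij ∈ Finset.HasAntidiagonal.antidiagonal n, a ij.1 * b ij.2 ^ 2 ^ ij.1

/-- Left multiplication by `τ` on sequences of coefficients. -/
def tauMul (a : ℕ → R) : ℕ → R
  | 0 => 0
  | n + 1 => a n ^ 2

/-- Right multiplication by `τ` on sequences of coefficients. -/
def mulTau (a : ℕ → R) : ℕ → R
  | 0 => 0
  | n + 1 => a n

/-- Right multiplication by the constant `w` on sequences of coefficients. -/
def mulConst (a : ℕ → R) (w : R) (n : ℕ) : R := a n * w ^ 2 ^ n

theorem skewMul_add_left (a a' b : ℕ → R) : skewMul (a + a') b = skewMul a b + skewMul a' b := by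
  ext n; simp [skewMul, add_mul, Finset.sum_add_distrib]

theorem skewMul_smul_left (c : R) (a b : ℕ → R) : skewMul (c • a) b = c • skewMul a b := by
  ext n; simp [skewMul, Finset.mul_sum, mul_assoc]

theorem skewMul_mulConst_left (a b : ℕ → R) (w : R) :
    skewMul (mulConst a w) b = skewMul a (w • b) := by
  ext n; simp [skewMul, mulConst, mul_pow, mul_assoc]

theorem skewMul_mulConst_right (a b : ℕ → R) (w : R) :
    skewMul a (mulConst b w) = mulConst (skewMul a b) w := by
  ext n
  simp only [skewMul, mulConst, Finset.sum_mul]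
  refine Finset.sum_congr rfl fun ij h => ?_
  rw [← Finset.HasAntidiagonal.mem_antidiagonal.mp h, mul_pow, ← pow_mul, ← pow_add, add_comm ij.2, mul_assoc]

theorem skewMul_mulTau_right (a b : ℕ → R) : skewMul a (mulTau b) = mulTau (skewMul a b) := by
  ext n
  cases n with
  | zero => simp [skewMul, mulTau]
  | succ n => simp [skewMul, mulTau, Finset.Nat.antidiagonal_succ']

theorem mulConst_mulConst (a : ℕ → R) (v w : R) :
    mulConst (mulConst a v) w = mulConst a (v * w) := by
  ext n; simp [mulConst, mul_pow, mul_assoc]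

theorem mulConst_one (a : ℕ → R) : mulConst a 1 = a := by
  ext n; simp [mulConst]

theorem mulConst_add_left (a b : ℕ → R) (w : R) :
    mulConst (a + b) w = mulConst a w + mulConst b w := by
  ext n; simp [mulConst, add_mul]

theorem mulConst_smul (c : R) (a : ℕ → R) (w : R) : mulConst (c • a) w = c • mulConst a w := by
  ext n; simp [mulConst, mul_assoc]

theorem mulConst_tauMul (a : ℕ → R) (w : R) : mulConst (tauMul a) w = tauMul (mulConst a w) := by
  ext n
  cases n with
  | zero => simp [mulConst, tauMul]
  | succ n => simp only [mulConst, tauMul]; ring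

variable [CharP R 2]

theorem mulConst_add_right (a : ℕ → R) (v w : R) :
    mulConst a (v + w) = mulConst a v + mulConst a w := by
  ext n; simp [mulConst, add_pow_char_pow, mul_add]

theorem skewMul_add_right (a b b' : ℕ → R) : skewMul a (b + b') = skewMul a b + skewMul a b' := by
  ext n; simp [skewMul, add_pow_char_pow, mul_add, Finset.sum_add_distrib]

/-- Associativity of $\tau\cdot a\cdot b$; characteristic 2 enters because squaring must distribute
over the convolution sum. -/
theorem skewMul_tauMul_left (a b : ℕ → R) : skewMul (tauMul a) b = tauMul (skewMul a b) := by
  ext n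
  cases n with
  | zero => simp [skewMul, tauMul]
  | succ n =>
    simp only [skewMul, tauMul, Finset.Nat.antidiagonal_succ, Finset.sum_cons, zero_mul, zero_add,
      Finset.sum_map]
    rw [← frobenius_def 2 (Finset.sum _ _), map_sum]
    refine Finset.sum_congr rfl fun ij _ => ?_
    simp only [frobenius_def, Function.Embedding.coe_prodMap, Prod.map_fst, Prod.map_snd,
      Function.Embedding.coeFn_mk, Function.Embedding.refl_apply, Nat.succ_eq_add_one]
    ring

end Skew

/-! ### Recursions for the coefficients of exp and log -/

/-- The coefficients `1 / dᵢ` of the exponential. -/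
noncomputable def expCoeff (i : ℕ) : K := PowerSeries.coeff (2 ^ i) expSeries

theorem coeff_two_pow_sq (f : PowerSeries K) :
    (fun n => PowerSeries.coeff (2 ^ n) (f ^ 2)) =
      tauMul fun n => PowerSeries.coeff (2 ^ n) f := by
  ext n
  rw [coeff_sq]
  cases n with
  | zero => simp [tauMul]
  | succ n => simp [tauMul, pow_succ]

theorem coeff_two_pow_pow_four (f : PowerSeries K) :
    (fun n => PowerSeries.coeff (2 ^ n) (f ^ 4)) =
      tauMul (tauMul fun n => PowerSeries.coeff (2 ^ n) f) := by
  rw [← coeff_two_pow_sq, ← coeff_two_pow_sq]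
  simp only [← pow_mul]

theorem coeff_two_pow_pow_eight (f : PowerSeries K) :
    (fun n => PowerSeries.coeff (2 ^ n) (f ^ 8)) =
      tauMul (tauMul (tauMul fun n => PowerSeries.coeff (2 ^ n) f)) := by
  rw [← coeff_two_pow_sq, ← coeff_two_pow_pow_four]
  simp only [← pow_mul]

/-- The functional equation in the form $e\cdot a=\rho_a\cdot e$ of an identity between twisted
series. -/
theorem mulConst_expCoeff (a : A) : mulConst expCoeff (algebraMap A K a) =
    fun n => PowerSeries.coeff (2 ^ n) (rho a expSeries) := by
  ext n
  rw [← isExponential_expSeries.functional a, PowerSeries.coeff_rescale, mul_comm]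
  rfl

theorem mulConst_expCoeff_xK : mulConst expCoeff xK =
    xK • expCoeff + (xK ^ 2 + xK) • tauMul expCoeff + tauMul (tauMul expCoeff) := by
  refine (mulConst_expCoeff xA).trans ?_
  ext n
  rw [rho_xA, rhoX_apply, map_add, map_add, PowerSeries.coeff_C_mul, PowerSeries.coeff_C_mul]
  have h2 := congrFun (coeff_two_pow_sq expSeries) n
  have h4 := congrFun (coeff_two_pow_pow_four expSeries) n
  rw [h2, h4]
  rfl

theorem mulConst_expCoeff_yK : mulConst expCoeff yK =
    yK • expCoeff + (yK ^ 2 + yK) • tauMul expCoeff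
      + (xK * (yK ^ 2 + yK)) • tauMul (tauMul expCoeff)
      + tauMul (tauMul (tauMul expCoeff)) := by
  refine (mulConst_expCoeff yA).trans ?_
  ext n
  rw [rho_yA, rhoY_apply, map_add, map_add, map_add, PowerSeries.coeff_C_mul,
    PowerSeries.coeff_C_mul, PowerSeries.coeff_C_mul]
  have h2 := congrFun (coeff_two_pow_sq expSeries) n
  have h4 := congrFun (coeff_two_pow_pow_four expSeries) n
  have h8 := congrFun (coeff_two_pow_pow_eight expSeries) n
  rw [h2, h4, h8]
  rfl

theorem expCoeff_zero : expCoeff 0 = 1 := isExponential_expSeries.coeff_one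

theorem expCoeff_rec (n : ℕ) : (xK ^ 2 ^ (n + 2) - xK) * expCoeff (n + 2) =
    (xK ^ 2 + xK) * expCoeff (n + 1) ^ 2 + expCoeff n ^ 4 := by
  have h := congrFun mulConst_expCoeff_xK (n + 2)
  simp only [mulConst, tauMul, Pi.add_apply, Pi.smul_apply, smul_eq_mul] at h
  linear_combination h

theorem xK_pow_two_pow_ne (n : ℕ) : xK ^ 2 ^ (n + 1) - xK ≠ 0 :=
  xK_pow_ne (by rw [pow_succ]; have := Nat.one_le_two_pow (n := n); omega)

theorem expCoeff_one : expCoeff 1 = 1 := by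
  have h := congrFun mulConst_expCoeff_xK 1
  simp only [mulConst, tauMul, Pi.add_apply, Pi.smul_apply, smul_eq_mul, expCoeff_zero] at h
  refine mul_left_cancel₀ (xK_pow_two_pow_ne 0) ?_
  have h2 : (2 : K) = 0 := CharTwo.two_eq_zero
  linear_combination h + xK * h2

/-- The coefficients of the logarithm, obtained by comparing coefficients in
`log(ρ_x(z)) = x log(z)`. -/
noncomputable def logCoeff : ℕ → K
  | 0 => 1
  | 1 => 1
  | n + 2 => (logCoeff (n + 1) * (xK ^ 2 + xK) ^ 2 ^ (n + 1) + logCoeff n)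
      / (xK ^ 2 ^ (n + 2) - xK)

theorem logCoeff_rec (n : ℕ) : (xK ^ 2 ^ (n + 2) - xK) * logCoeff (n + 2) =
    logCoeff (n + 1) * (xK ^ 2 + xK) ^ 2 ^ (n + 1) + logCoeff n := by
  rw [logCoeff, mul_div_cancel₀ _ (xK_pow_two_pow_ne (n + 1))]

/-- The identity $x\log=\log\rho_x$ of twisted series. Its coefficient at index 1 holds with
$1/\ell_1=1$ because $x^2-x=x^2+x$. -/
theorem xK_smul_logCoeff : xK • logCoeff = mulConst logCoeff xK
    + mulTau (mulConst logCoeff (xK ^ 2 + xK)) + mulTau (mulTau logCoeff) := by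
  have h2 : (2 : K) = 0 := CharTwo.two_eq_zero
  ext n
  simp only [Pi.add_apply, Pi.smul_apply, smul_eq_mul, mulConst]
  match n with
  | 0 => simp [mulTau, logCoeff]
  | 1 =>
    simp only [mulTau, mulConst, logCoeff]
    linear_combination (-xK ^ 2) * h2
  | n + 2 =>
    simp only [mulTau, mulConst]
    linear_combination -logCoeff_rec n
      - (logCoeff (n + 1) * (xK ^ 2 + xK) ^ 2 ^ (n + 1) + logCoeff n) * h2

/-! ### The series $e(w\log z)$ and the identity $e\circ\log=1$ -/

/-- The value at `w` of `p_k`, as a sequence in `k`: the coefficients of `e(w log(z))`. -/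
noncomputable def pSeq (w : K) : ℕ → K := skewMul (mulConst expCoeff w) logCoeff

theorem pSeq_add (v w : K) : pSeq (v + w) = pSeq v + pSeq w := by
  rw [pSeq, mulConst_add_right, skewMul_add_left]; rfl

/-- Since $e\cdot x=\rho_x\cdot e$, the operator $\rho_x$ comes out on the left of $e\cdot
w\cdot\log$. -/
theorem pSeq_xK_mul (w : K) : pSeq (xK * w) =
    xK • pSeq w + (xK ^ 2 + xK) • tauMul (pSeq w) + tauMul (tauMul (pSeq w)) := by
  rw [pSeq, ← mulConst_mulConst, mulConst_expCoeff_xK]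
  simp only [mulConst_add_left, mulConst_smul, mulConst_tauMul, skewMul_add_left,
    skewMul_smul_left, skewMul_tauMul_left, pSeq]

theorem pSeq_yK_mul (w : K) : pSeq (yK * w) =
    yK • pSeq w + (yK ^ 2 + yK) • tauMul (pSeq w)
      + (xK * (yK ^ 2 + yK)) • tauMul (tauMul (pSeq w)) + tauMul (tauMul (tauMul (pSeq w))) := by
  rw [pSeq, ← mulConst_mulConst, mulConst_expCoeff_yK]
  simp only [mulConst_add_left, mulConst_smul, mulConst_tauMul, skewMul_add_left,
    skewMul_smul_left, skewMul_tauMul_left, pSeq]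

theorem pSeq_one_eq : pSeq 1 = skewMul expCoeff logCoeff := by rw [pSeq, mulConst_one]

/-- `e ∘ log` commutes with `ρ_x`. -/
theorem pSeq_one_commute : xK • pSeq 1 + (xK ^ 2 + xK) • tauMul (pSeq 1)
      + tauMul (tauMul (pSeq 1)) =
    mulConst (pSeq 1) xK + mulTau (mulConst (pSeq 1) (xK ^ 2 + xK)) + mulTau (mulTau (pSeq 1)) := by
  -- The constant $x$ between $e$ and $\log$ is absorbed by $\log$ instead, which brings $\rho_x$
  -- out on the right.
  rw [← pSeq_xK_mul, mul_one, pSeq, skewMul_mulConst_left, xK_smul_logCoeff, skewMul_add_right,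
    skewMul_add_right, skewMul_mulTau_right, skewMul_mulTau_right, skewMul_mulTau_right,
    skewMul_mulConst_right, skewMul_mulConst_right, pSeq_one_eq]

theorem pSeq_one_zero : pSeq 1 0 = 1 := by
  simp [pSeq_one_eq, skewMul, expCoeff_zero, logCoeff]

/-- A twisted series commuting with $\rho_x$ is determined by its constant term: comparing
coefficients gives $(x^{2^{n+1}}-x)c_{n+1}$ in terms of $c_n$ and $c_{n-1}$. With $c_0=1$ the
contributions of $c_0$ to the two sides cancel. -/
theorem pSeq_one_succ (n : ℕ) : pSeq 1 (n + 1) = 0 := by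
  induction n using Nat.strong_induction_on with
  | _ n ih =>
    have h := congrFun pSeq_one_commute (n + 1)
    refine (mul_eq_zero.mp ?_).resolve_left (xK_pow_two_pow_ne n)
    match n with
    | 0 =>
      simp only [mulConst, tauMul, mulTau, Pi.add_apply, Pi.smul_apply, smul_eq_mul,
        pSeq_one_zero] at h
      linear_combination -h
    | 1 =>
      simp only [mulConst, tauMul, mulTau, Pi.add_apply, Pi.smul_apply, smul_eq_mul,
        pSeq_one_zero, ih 0 one_pos] at h
      linear_combination -h
    | n + 2 =>
      simp only [mulConst, tauMul, mulTau, Pi.add_apply, Pi.smul_apply, smul_eq_mul,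
        ih n (by omega), ih (n + 1) (by omega)] at h
      linear_combination -h

/-! ### Substitution of additive power series -/

theorem coeff_mul_pow_two_pow (f : PowerSeries K) (i m : ℕ) :
    PowerSeries.coeff (2 ^ i * m) (f ^ 2 ^ i) = PowerSeries.coeff m f ^ 2 ^ i := by
  induction i with
  | zero => simp
  | succ i ih =>
    rw [pow_succ, pow_mul, coeff_sq, if_pos ⟨2 ^ i * m, by ring⟩, pow_mul,
      show 2 ^ i * 2 * m / 2 = 2 ^ i * m by rw [mul_right_comm, Nat.mul_div_cancel _ two_pos], ih]

theorem coeff_pow_two_pow_of_not_dvd (f : PowerSeries K) {i n : ℕ} (h : ¬ 2 ^ i ∣ n) :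
    PowerSeries.coeff n (f ^ 2 ^ i) = 0 := by
  induction i generalizing n with
  | zero => simp at h
  | succ i ih =>
    rw [pow_succ, pow_mul, coeff_sq]
    split_ifs with h2
    · rw [ih fun hd => h ?_, zero_pow two_ne_zero]
      obtain ⟨m, rfl⟩ := h2
      rw [Nat.mul_div_cancel_left _ two_pos] at hd
      rw [pow_succ']
      exact mul_dvd_mul_left 2 hd
    · rfl

/-- The additive power series `∑ bᵢ z^(2^i)`. -/
noncomputable def additiveSeries (b : ℕ → K) : PowerSeries K :=
  PowerSeries.mk fun n => if n = 2 ^ Nat.log 2 n then b (Nat.log 2 n) else 0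

theorem coeff_additiveSeries (b : ℕ → K) (i : ℕ) :
    PowerSeries.coeff (2 ^ i) (additiveSeries b) = b i := by
  simp [additiveSeries, Nat.log_pow]

theorem coeff_additiveSeries_of_ne (b : ℕ → K) {n : ℕ} (h : ∀ i : ℕ, n ≠ 2 ^ i) :
    PowerSeries.coeff n (additiveSeries b) = 0 := by
  simp [additiveSeries, h]

theorem constantCoeff_additiveSeries (b : ℕ → K) :
    PowerSeries.constantCoeff (additiveSeries b) = 0 := by
  rw [← PowerSeries.coeff_zero_eq_constantCoeff_apply]
  exact coeff_additiveSeries_of_ne b fun i => (pow_pos two_pos i).ne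

theorem coeff_additiveSeries_pow (b : ℕ → K) (i n : ℕ)
    (h : PowerSeries.coeff n (additiveSeries b ^ 2 ^ i) ≠ 0) : ∃ j, n = 2 ^ (i + j) := by
  by_cases hd : 2 ^ i ∣ n
  · obtain ⟨m, rfl⟩ := hd
    rw [coeff_mul_pow_two_pow] at h
    by_contra! hm
    refine h ?_
    rw [coeff_additiveSeries_of_ne, zero_pow (pow_pos two_pos i).ne']
    rintro j rfl
    exact hm j (pow_add 2 i j).symm
  · exact absurd (coeff_pow_two_pow_of_not_dvd _ hd) h

/-- Composition of additive series is the product of twisted series: only the powers $f^{2^i}$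
contribute, and these are Frobenius twists. -/
theorem coeff_subst_additiveSeries (e : PowerSeries K) (b : ℕ → K)
    (he : ∀ n : ℕ, (∀ i : ℕ, n ≠ 2 ^ i) → PowerSeries.coeff n e = 0) (n : ℕ) :
    PowerSeries.coeff (2 ^ n) (e.subst (additiveSeries b)) =
      skewMul (fun i => PowerSeries.coeff (2 ^ i) e) b n := by
  rw [PowerSeries.coeff_subst'
    (PowerSeries.HasSubst.of_constantCoeff_zero' (constantCoeff_additiveSeries b)),
    finsum_eq_sum_of_support_subset (s := (Finset.range (n + 1)).image fun i => 2 ^ i),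
    Finset.sum_image fun i _ j _ h => Nat.pow_right_injective le_rfl h, skewMul,
    Finset.Nat.sum_antidiagonal_eq_sum_range_succ
      (fun i j => PowerSeries.coeff (2 ^ i) e * b j ^ 2 ^ i)]
  · refine Finset.sum_congr rfl fun i hi => ?_
    have hi' : i ≤ n := Nat.lt_succ_iff.mp (Finset.mem_range.mp hi)
    rw [show 2 ^ n = 2 ^ i * 2 ^ (n - i) by rw [← pow_add, Nat.add_sub_cancel' hi'],
      coeff_mul_pow_two_pow, coeff_additiveSeries, smul_eq_mul]
  · intro m hm
    rw [Function.mem_support, smul_ne_zero_iff] at hm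
    have : ∃ i, m = 2 ^ i := by
      by_contra! h
      exact hm.1 (he m h)
    obtain ⟨i, rfl⟩ := this
    obtain ⟨j, hj⟩ := coeff_additiveSeries_pow b i _ hm.2
    have := Nat.pow_right_injective le_rfl hj
    rw [Finset.mem_coe, Finset.mem_image]
    exact ⟨i, Finset.mem_range.mpr (by omega), rfl⟩

theorem coeff_subst_additiveSeries_of_ne (e : PowerSeries K) (b : ℕ → K)
    (he : ∀ n : ℕ, (∀ i : ℕ, n ≠ 2 ^ i) → PowerSeries.coeff n e = 0) {n : ℕ}
    (hn : ∀ i : ℕ, n ≠ 2 ^ i) :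
    PowerSeries.coeff n (e.subst (additiveSeries b)) = 0 := by
  rw [PowerSeries.coeff_subst'
    (PowerSeries.HasSubst.of_constantCoeff_zero' (constantCoeff_additiveSeries b))]
  refine finsum_eq_zero_of_forall_eq_zero fun m => ?_
  by_contra hm
  rw [← ne_eq, smul_ne_zero_iff] at hm
  have : ∃ i, m = 2 ^ i := by
    by_contra! h
    exact hm.1 (he m h)
  obtain ⟨i, rfl⟩ := this
  obtain ⟨j, hj⟩ := coeff_additiveSeries_pow b i _ hm.2
  exact hn _ hj

theorem exp_subst_additiveSeries_logCoeff :
    expSeries.subst (additiveSeries logCoeff) = (PowerSeries.X : PowerSeries K) := by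
  ext n
  by_cases hn : ∀ i : ℕ, n ≠ 2 ^ i
  · rw [coeff_subst_additiveSeries_of_ne _ _ isExponential_expSeries.coeff_eq_zero hn,
      PowerSeries.coeff_X, if_neg (show n ≠ 1 from hn 0)]
  · push Not at hn
    obtain ⟨i, rfl⟩ := hn
    rw [coeff_subst_additiveSeries _ _ isExponential_expSeries.coeff_eq_zero]
    refine (congrFun pSeq_one_eq i).symm.trans ?_
    cases i with
    | zero => rw [pSeq_one_zero]; simp
    | succ i =>
      have : 2 ^ (i + 1) ≠ 1 := by simp
      rw [pSeq_one_succ, PowerSeries.coeff_X, if_neg this]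

theorem constantCoeff_expSeries : PowerSeries.constantCoeff expSeries = 0 := by
  rw [← PowerSeries.coeff_zero_eq_constantCoeff_apply]
  exact isExponential_expSeries.coeff_eq_zero 0 fun i => (pow_pos two_pos i).ne

/-- A left inverse and a right inverse of $e$ under composition coincide. -/
theorem logSeries_eq : logSeries = additiveSeries logCoeff := by
  have hL := PowerSeries.HasSubst.of_constantCoeff_zero' (constantCoeff_additiveSeries logCoeff)
  have hE := PowerSeries.HasSubst.of_constantCoeff_zero' constantCoeff_expSeries
  have h : logSeries.subst expSeries = (PowerSeries.X : PowerSeries K) :=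
    expSeries.subst_substInvOfIsUnit_left constantCoeff_expSeries isUnit_coeff_one_expSeries
  have h2 := PowerSeries.subst_comp_subst_apply hE hL logSeries
  rw [h, exp_subst_additiveSeries_logCoeff, PowerSeries.subst_X hL, PowerSeries.X_subst] at h2
  exact h2.symm

theorem coeff_logSeries (i : ℕ) : PowerSeries.coeff (2 ^ i) logSeries = logCoeff i := by
  rw [logSeries_eq, coeff_additiveSeries]

/-! ### Nonvanishing of the coefficients -/

section Nonvanishing

/-- The embedding `𝔽₂[x] → K`. -/
noncomputable def ofPoly : (ZMod 2)[X] →+* K := (algebraMap A K).comp (algebraMap (ZMod 2)[X] A)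

theorem ofPoly_injective : Function.Injective ofPoly :=
  (IsFractionRing.injective A K).comp (FaithfulSMul.algebraMap_injective (ZMod 2)[X] A)

theorem ofPoly_X : ofPoly X = xK := rfl

/-- `[n] = x^(2^n) + x`. -/
noncomputable def bracket (n : ℕ) : (ZMod 2)[X] := X ^ 2 ^ n + X

theorem ofPoly_bracket (n : ℕ) : ofPoly (bracket n) = xK ^ 2 ^ n - xK := by
  rw [bracket, map_add, map_pow, ofPoly_X, CharTwo.sub_eq_add]

theorem monic_bracket (n : ℕ) : (bracket (n + 1)).Monic :=
  monic_X_pow_add (by rw [degree_X]; exact_mod_cast Nat.one_lt_two_pow n.succ_ne_zero)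

theorem natDegree_bracket (n : ℕ) : (bracket (n + 1)).natDegree = 2 ^ (n + 1) := by
  rw [bracket, natDegree_add_eq_left_of_natDegree_lt, natDegree_X_pow]
  rw [natDegree_X_pow, natDegree_X]
  exact Nat.one_lt_two_pow n.succ_ne_zero

theorem monic_add_and_natDegree {R : Type*} [CommRing R] [Nontrivial R] {p q : R[X]}
    (hp : p.Monic) (h : q.natDegree < p.natDegree) :
    (p + q).Monic ∧ (p + q).natDegree = p.natDegree :=
  ⟨hp.add_of_left (degree_lt_degree h), natDegree_add_eq_left_of_natDegree_lt h⟩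

/-- The numerators of the coefficients of the logarithm. -/
noncomputable def logNum : ℕ → (ZMod 2)[X]
  | 0 => 1
  | 1 => bracket 1
  | n + 2 => logNum (n + 1) * bracket 1 ^ 2 ^ (n + 1) + logNum n * bracket (n + 1)

/-- In the recursion the first summand has degree $2^{n+3}-2$ and the second only $2^{n+2}-2$, so
the leading term never cancels. -/
theorem logNum_monic (n : ℕ) : ((logNum n).Monic ∧ (logNum n).natDegree + 2 = 2 ^ (n + 1)) ∧
    ((logNum (n + 1)).Monic ∧ (logNum (n + 1)).natDegree + 2 = 2 ^ (n + 2)) := by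
  induction n with
  | zero => simp [logNum, monic_bracket 0, natDegree_bracket 0]
  | succ n ih =>
    obtain ⟨⟨h1, h2⟩, h3, h4⟩ := ih
    refine ⟨⟨h3, h4⟩, ?_⟩
    have hb : (bracket 1 ^ 2 ^ (n + 1)).Monic := (monic_bracket 0).pow _
    have d1 : (logNum (n + 1) * bracket 1 ^ 2 ^ (n + 1)).natDegree + 2 = 2 ^ (n + 1 + 2) := by
      rw [h3.natDegree_mul hb, (monic_bracket 0).natDegree_pow, natDegree_bracket 0]
      have : 2 ^ (n + 1 + 2) = 2 ^ (n + 2) + 2 ^ (n + 1) * 2 := by ring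
      rw [this, ← h4]
      ring
    have d2 : (logNum n * bracket (n + 1)).natDegree + 2 = 2 ^ (n + 2) := by
      rw [h1.natDegree_mul (monic_bracket n), natDegree_bracket]
      have : 2 ^ (n + 2) = 2 ^ (n + 1) + 2 ^ (n + 1) := by ring
      rw [this]
      nth_rewrite 2 [← h2]
      ring
    have hlt : 2 ^ (n + 2) < 2 ^ (n + 1 + 2) := Nat.pow_lt_pow_right one_lt_two (by omega)
    have := monic_add_and_natDegree (h3.mul hb)
      (q := logNum n * bracket (n + 1)) (by omega)
    rw [logNum]
    exact ⟨this.1, by rw [this.2, d1]⟩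

/-- The denominators of the coefficients of the logarithm. -/
noncomputable def logDen : ℕ → (ZMod 2)[X]
  | 0 => 1
  | n + 1 => logDen n * bracket (n + 1)

theorem logCoeff_mul_logDen (n : ℕ) : logCoeff n * ofPoly (logDen n) = ofPoly (logNum n) ∧
    logCoeff (n + 1) * ofPoly (logDen (n + 1)) = ofPoly (logNum (n + 1)) := by
  induction n with
  | zero => simp [logCoeff, logDen, logNum]
  | succ n ih =>
    refine ⟨ih.2, ?_⟩
    have h := logCoeff_rec n
    rw [logDen, logNum]
    simp only [map_mul, map_add, map_pow, ← ih.1, ← ih.2]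
    have hb : ofPoly (bracket 1) = xK ^ 2 + xK := by
      rw [bracket, map_add, map_pow, ofPoly_X]; rfl
    rw [hb, ofPoly_bracket (n + 1 + 1)]
    rw [show logDen (n + 1) = logDen n * bracket (n + 1) from rfl, map_mul]
    -- The recursion for the coefficients is multiplied by `logDen (n + 1)`.
    linear_combination ofPoly (logDen n) * ofPoly (bracket (n + 1)) * h

theorem logCoeff_ne_zero (n : ℕ) : logCoeff n ≠ 0 := by
  intro h
  have h1 := (logCoeff_mul_logDen n).1
  rw [h, zero_mul, eq_comm, map_eq_zero_iff _ ofPoly_injective] at h1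
  exact (logNum_monic n).1.1.ne_zero h1

/-- The numerators of the coefficients of the exponential. -/
noncomputable def expNum : ℕ → (ZMod 2)[X]
  | 0 => 1
  | 1 => bracket 1
  | n + 2 => bracket (n + 1) ^ 2 * expNum n ^ 4 + bracket 1 * expNum (n + 1) ^ 2

/-- From `expNum 3` on, the summand with the fourth power has the larger degree and decides the
leading term. -/
theorem expNum_monic (n : ℕ) :
    ((expNum (n + 1)).Monic ∧ (expNum (n + 1)).natDegree = 2 ^ n * (n + 2)) ∧
    ((expNum (n + 2)).Monic ∧ (expNum (n + 2)).natDegree = 2 ^ (n + 1) * (n + 3)) := by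
  induction n with
  | zero =>
    have h1 : expNum 1 = bracket 1 := rfl
    -- Here the roles are reversed: the summand with `expNum 1 ^ 2` has degree 6, the other one
    -- degree 4.
    have h2 : expNum 2 = bracket 1 * bracket 1 ^ 2 + bracket 1 ^ 2 := by
      simp [expNum, add_comm]
    have hm := (monic_bracket 0).mul ((monic_bracket 0).pow 2)
    have hd : (bracket 1 * bracket 1 ^ 2).natDegree = 6 := by
      rw [(monic_bracket 0).natDegree_mul ((monic_bracket 0).pow 2),
        (monic_bracket 0).natDegree_pow, natDegree_bracket 0]; rfl
    have := monic_add_and_natDegree hm (q := bracket 1 ^ 2) (by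
      rw [(monic_bracket 0).natDegree_pow, natDegree_bracket 0]
      exact lt_of_lt_of_eq (by norm_num) hd.symm)
    rw [zero_add, zero_add, h1, h2]
    exact ⟨⟨monic_bracket 0, natDegree_bracket 0⟩, this.1, this.2.trans hd⟩
  | succ n ih =>
    obtain ⟨⟨h1, h2⟩, h3, h4⟩ := ih
    refine ⟨⟨h3, h4⟩, ?_⟩
    have hm := ((monic_bracket (n + 1)).pow 2).mul (h1.pow 4)
    have d1 : (bracket (n + 2) ^ 2 * expNum (n + 1) ^ 4).natDegree = 2 ^ (n + 2) * (n + 4) := by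
      rw [((monic_bracket (n + 1)).pow 2).natDegree_mul (h1.pow 4),
        (monic_bracket (n + 1)).natDegree_pow, natDegree_bracket, h1.natDegree_pow, h2]
      ring
    have d2 : (bracket 1 * expNum (n + 2) ^ 2).natDegree = 2 + 2 ^ (n + 2) * (n + 3) := by
      rw [(monic_bracket 0).natDegree_mul (h3.pow 2), natDegree_bracket, h3.natDegree_pow, h4]
      ring
    have hlt : 2 + 2 ^ (n + 2) * (n + 3) < 2 ^ (n + 2) * (n + 4) := by
      have : 2 < 2 ^ (n + 2) := lt_of_lt_of_le (by norm_num)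
        (Nat.pow_le_pow_right two_pos (show 2 ≤ n + 2 by omega))
      nlinarith
    have := monic_add_and_natDegree hm (q := bracket 1 * expNum (n + 2) ^ 2)
      (by rw [d2]; exact lt_of_lt_of_eq hlt d1.symm)
    rw [expNum]
    exact ⟨this.1, this.2.trans d1⟩

/-- The denominators of the coefficients of the exponential. -/
noncomputable def expDen : ℕ → (ZMod 2)[X]
  | 0 => 1
  | n + 1 => bracket (n + 1) * expDen n ^ 2

theorem expCoeff_mul_expDen (n : ℕ) : expCoeff n * ofPoly (expDen n) = ofPoly (expNum n) ∧
    expCoeff (n + 1) * ofPoly (expDen (n + 1)) = ofPoly (expNum (n + 1)) := by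
  induction n with
  | zero => simp [expCoeff_zero, expCoeff_one, expDen, expNum]
  | succ n ih =>
    refine ⟨ih.2, ?_⟩
    have h := expCoeff_rec n
    rw [expDen, expNum]
    simp only [map_mul, map_add, map_pow, ← ih.1, ← ih.2]
    have hb : ofPoly (bracket 1) = xK ^ 2 + xK := by
      rw [bracket, map_add, map_pow, ofPoly_X]; rfl
    rw [hb, ofPoly_bracket (n + 1 + 1)]
    rw [show expDen (n + 1) = bracket (n + 1) * expDen n ^ 2 from rfl, map_mul, map_pow]
    linear_combination (ofPoly (bracket (n + 1)) * ofPoly (expDen n) ^ 2) ^ 2 * h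

theorem expCoeff_ne_zero (n : ℕ) : expCoeff n ≠ 0 := by
  cases n with
  | zero => rw [expCoeff_zero]; exact one_ne_zero
  | succ n =>
    intro h
    have h1 := (expCoeff_mul_expDen n).2
    rw [h, zero_mul, eq_comm, map_eq_zero_iff _ ofPoly_injective] at h1
    exact (expNum_monic n).1.1.ne_zero h1

end Nonvanishing

/-! ### The filtration of $A$ by degree -/

section Degree

theorem two_nsmul_degree_add_lt_iff (p : (ZMod 2)[X]) (c k : ℕ) :
    2 • p.degree + (c : WithBot ℕ) < k ↔ ∀ n, p.coeff n ≠ 0 → 2 * n + c < k := by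
  rcases eq_or_ne p 0 with rfl | hp
  · simp
  · have h : 2 • p.degree + (c : WithBot ℕ) = ((2 * p.natDegree + c : ℕ) : WithBot ℕ) := by
      rw [degree_eq_natDegree hp]; simp
    rw [h, Nat.cast_lt]
    refine ⟨fun hk n hn => ?_, fun H => H _ (leadingCoeff_ne_zero.mpr hp)⟩
    have := le_natDegree_of_ne_zero hn
    omega

/-- The condition on single coefficients avoids the degree $-\infty$ and makes closure under
addition immediate. -/
theorem deg_lt_iff (p q : (ZMod 2)[X]) (k : ℕ) : deg (p • (1 : A) + q • yA) < k ↔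
    (∀ n, p.coeff n ≠ 0 → 2 * n < k) ∧ ∀ n, q.coeff n ≠ 0 → 2 * n + 3 < k := by
  rw [deg_eq, max_lt_iff]
  have h1 := two_nsmul_degree_add_lt_iff p 0 k
  have h2 := two_nsmul_degree_add_lt_iff q 3 k
  simp only [Nat.cast_zero, add_zero] at h1
  exact and_congr h1 h2

theorem exists_eq_smul_add_smul (a : A) :
    ∃ p q : (ZMod 2)[X], p • (1 : A) + q • yA = a :=
  WeierstrassCurve.Affine.CoordinateRing.exists_smul_basis_eq a

theorem smul_add_smul_add (p q p' q' : (ZMod 2)[X]) :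
    (p • (1 : A) + q • yA) + (p' • (1 : A) + q' • yA) = (p + p') • (1 : A) + (q + q') • yA := by
  rw [add_smul, add_smul]; abel

theorem deg_add_lt {a b : A} {k : ℕ} (ha : deg a < k) (hb : deg b < k) : deg (a + b) < k := by
  obtain ⟨p, q, rfl⟩ := exists_eq_smul_add_smul a
  obtain ⟨p', q', rfl⟩ := exists_eq_smul_add_smul b
  rw [smul_add_smul_add]
  rw [deg_lt_iff] at ha hb ⊢
  refine ⟨fun n hn => ?_, fun n hn => ?_⟩
  · by_cases h : p.coeff n = 0
    · rw [coeff_add, h, zero_add] at hn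
      exact hb.1 n hn
    · exact ha.1 n h
  · by_cases h : q.coeff n = 0
    · rw [coeff_add, h, zero_add] at hn
      exact hb.2 n hn
    · exact ha.2 n h

theorem zmod_two_eq_one {c : ZMod 2} (h : c ≠ 0) : c = 1 := by
  revert c; decide

theorem coeff_X_pow_add_ne_zero {p : (ZMod 2)[X]} {m n : ℕ} (hm : p.coeff m ≠ 0)
    (hn : (X ^ m + p).coeff n ≠ 0) : n ≠ m ∧ p.coeff n ≠ 0 := by
  rw [coeff_add, coeff_X_pow] at hn
  by_cases h : n = m
  · subst h
    rw [if_pos rfl, zmod_two_eq_one hm] at hn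
    exact absurd (by decide) hn
  · rw [if_neg h, zero_add] at hn
    exact ⟨h, hn⟩

/-- For `k ≥ 2` there is an element of degree `k`, unique up to elements of smaller degree. -/
theorem exists_deg_eq (k : ℕ) (hk : 2 ≤ k) : ∃ g : A, deg g < (k + 1 : ℕ) ∧ ¬ deg g < k ∧
    ∀ a : A, deg a < (k + 1 : ℕ) → deg a < k ∨ deg (g + a) < k := by
  have hX : ∀ m n : ℕ, (X ^ m : (ZMod 2)[X]).coeff n ≠ 0 → n = m := by
    intro m n h
    by_contra h'
    exact h (by rw [coeff_X_pow, if_neg h'])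
  rcases Nat.even_or_odd' k with ⟨m, rfl | rfl⟩
  · refine ⟨(X ^ m : (ZMod 2)[X]) • (1 : A) + (0 : (ZMod 2)[X]) • yA, ?_, ?_, fun a ha => ?_⟩
    · rw [deg_lt_iff]
      exact ⟨fun n hn => by have := hX _ _ hn; omega, fun n hn => absurd (coeff_zero n) hn⟩
    · rw [deg_lt_iff]
      exact fun h => absurd (h.1 m (by simp)) (lt_irrefl _)
    · obtain ⟨p, q, rfl⟩ := exists_eq_smul_add_smul a
      rw [smul_add_smul_add, zero_add]
      rw [deg_lt_iff] at ha
      rw [deg_lt_iff, deg_lt_iff]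
      have hq : ∀ n, q.coeff n ≠ 0 → 2 * n + 3 < 2 * m := fun n hn => by
        have := ha.2 n hn; omega
      by_cases h : p.coeff m = 0
      · refine Or.inl ⟨fun n hn => ?_, hq⟩
        have h1 := ha.1 n hn
        have h2 : n ≠ m := by rintro rfl; exact hn h
        omega
      · refine Or.inr ⟨fun n hn => ?_, hq⟩
        obtain ⟨h2, h3⟩ := coeff_X_pow_add_ne_zero h hn
        have h1 := ha.1 n h3
        omega
  -- An odd $k\ge3$ is written $2m+3=\deg(x^my)$; this is where $k=1$ must be excluded.
  · obtain ⟨m, rfl⟩ : ∃ l, m = l + 1 := ⟨m - 1, by omega⟩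
    refine ⟨(0 : (ZMod 2)[X]) • (1 : A) + (X ^ m : (ZMod 2)[X]) • yA, ?_, ?_, fun a ha => ?_⟩
    · rw [deg_lt_iff]
      exact ⟨fun n hn => absurd (coeff_zero n) hn, fun n hn => by have := hX _ _ hn; omega⟩
    · rw [deg_lt_iff]
      exact fun h => absurd (h.2 m (by simp)) (by omega)
    · obtain ⟨p, q, rfl⟩ := exists_eq_smul_add_smul a
      rw [smul_add_smul_add, zero_add]
      rw [deg_lt_iff] at ha
      rw [deg_lt_iff, deg_lt_iff]
      have hp : ∀ n, p.coeff n ≠ 0 → 2 * n < 2 * (m + 1) + 1 := fun n hn => by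
        have := ha.1 n hn; omega
      by_cases h : q.coeff m = 0
      · refine Or.inl ⟨hp, fun n hn => ?_⟩
        have h1 := ha.2 n hn
        have h2 : n ≠ m := by rintro rfl; exact hn h
        omega
      · refine Or.inr ⟨hp, fun n hn => ?_⟩
        obtain ⟨h2, h3⟩ := coeff_X_pow_add_ne_zero h hn
        have h1 := ha.2 n h3
        omega

theorem mem_Alt {a : A} {k : ℕ} : a ∈ Alt k ↔ deg a < k := by
  rw [Alt, Set.Finite.mem_toFinset, Set.mem_ofPred_eq]

instance : CharP A 2 := charP_of_injective_algebraMap (algebraMap (ZMod 2) A).injective 2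

open Classical in
-- The residue field is $\mathbb{F}_2$, so one step of the filtration adds exactly one coset.
theorem exists_Alt_succ (k : ℕ) (hk : 2 ≤ k) : ∃ g : A,
    Disjoint (Alt k) ((Alt k).image (g + ·)) ∧ Alt (k + 1) = Alt k ∪ (Alt k).image (g + ·) := by
  obtain ⟨g, h1, h2, h3⟩ := exists_deg_eq k hk
  have hgg : ∀ a : A, g + (g + a) = a := CharTwo.add_cancel_left g
  have hlt : ∀ a : A, deg a < k → deg a < (k + 1 : ℕ) := fun a ha =>
    ha.trans (Nat.cast_lt.mpr k.lt_succ_self)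
  refine ⟨g, ?_, ?_⟩
  · rw [Finset.disjoint_left]
    intro a ha ha'
    obtain ⟨b, hb, rfl⟩ := Finset.mem_image.mp ha'
    refine h2 ?_
    have := deg_add_lt (mem_Alt.mp hb) (mem_Alt.mp ha)
    rwa [add_comm g, CharTwo.add_cancel_left] at this
  · ext a
    rw [Finset.mem_union, Finset.mem_image, mem_Alt, mem_Alt]
    constructor
    · intro ha
      rcases h3 a ha with h | h
      · exact Or.inl h
      · exact Or.inr ⟨g + a, mem_Alt.mpr h, hgg a⟩
    · rintro (h | ⟨b, hb, rfl⟩)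
      · exact hlt a h
      · exact deg_add_lt h1 (hlt b (mem_Alt.mp hb))

open Classical in
theorem Alt_two : Alt 2 = {0, 1} := by
  ext a
  obtain ⟨p, q, rfl⟩ := exists_eq_smul_add_smul a
  rw [mem_Alt, deg_lt_iff, Finset.mem_insert, Finset.mem_singleton]
  constructor
  · rintro ⟨hp, hq⟩
    have hq0 : q = 0 := by
      ext n
      by_contra h
      have := hq n h
      omega
    have hp0 : p = C (p.coeff 0) := by
      ext n
      rw [coeff_C]
      split_ifs with h
      · rw [h]
      · by_contra h'
        have := hp n h'
        omega
    rw [hq0, zero_smul, add_zero, hp0]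
    by_cases h : p.coeff 0 = 0
    · left; rw [h, C_0, zero_smul]
    · right; rw [zmod_two_eq_one h, C_1, one_smul]
  · intro h
    have h0 : ∀ c : ZMod 2, p • (1 : A) + q • yA = (C c) • (1 : A) → p = C c ∧ q = 0 := by
      intro c hc
      have h1 : (p - C c) • (1 : A) + q • yA = 0 := by
        rw [sub_smul, ← hc]; abel
      obtain ⟨h2, h3⟩ := WeierstrassCurve.Affine.CoordinateRing.smul_basis_eq_zero h1
      exact ⟨sub_eq_zero.mp h2, h3⟩
    obtain ⟨c, hp, hq⟩ : ∃ c, p = C c ∧ q = 0 := by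
      rcases h with h | h
      · exact ⟨0, h0 0 (by rw [h, C_0, zero_smul])⟩
      · exact ⟨1, h0 1 (by rw [h, C_1, one_smul])⟩
    subst hp hq
    refine ⟨fun n hn => ?_, fun n hn => absurd (coeff_zero n) hn⟩
    rw [coeff_C] at hn
    have : n = 0 := by
      by_contra h'
      exact hn (if_neg h')
    omega

end Degree

/-! ### Linearized polynomials and the shape of $e_k$ -/

section Linearized

variable {R : Type*} [CommRing R]

/-- The linearized polynomial `∑_{i < n} fᵢ w^(2^i)`. -/
noncomputable def linPoly (f : ℕ → R) (n : ℕ) : R[X] :=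
  ∑ i ∈ Finset.range n, C (f i) * X ^ 2 ^ i

theorem linPoly_succ (f : ℕ → R) (n : ℕ) :
    linPoly f (n + 1) = linPoly f n + C (f n) * X ^ 2 ^ n := Finset.sum_range_succ _ _

theorem linPoly_succ_of_eq_zero {f : ℕ → R} {n : ℕ} (h : f n = 0) :
    linPoly f (n + 1) = linPoly f n := by
  rw [linPoly_succ, h, C_0, zero_mul, add_zero]

theorem linPoly_add (f g : ℕ → R) (n : ℕ) : linPoly (f + g) n = linPoly f n + linPoly g n := by
  simp [linPoly, add_mul, Finset.sum_add_distrib]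

theorem linPoly_smul (c : R) (f : ℕ → R) (n : ℕ) : linPoly (c • f) n = C c * linPoly f n := by
  simp [linPoly, Finset.mul_sum, mul_assoc]

theorem coeff_linPoly (f : ℕ → R) {i n : ℕ} (h : i < n) : (linPoly f n).coeff (2 ^ i) = f i := by
  rw [linPoly, finsetSum_coeff, Finset.sum_eq_single i]
  · simp
  · intro j _ hj
    rw [coeff_C_mul_X_pow, if_neg fun h' => hj (Nat.pow_right_injective le_rfl h').symm]
  · intro h'
    exact absurd (Finset.mem_range.mpr h) h'

theorem natDegree_linPoly_succ_le (f : ℕ → R) (n : ℕ) : (linPoly f (n + 1)).natDegree ≤ 2 ^ n := by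
  refine natDegree_sum_le_of_forall_le _ _ fun i hi => (natDegree_C_mul_X_pow_le _ _).trans ?_
  exact Nat.pow_le_pow_right two_pos (Nat.lt_succ_iff.mp (Finset.mem_range.mp hi))

variable [CharP R 2]

theorem linPoly_sq (f : ℕ → R) (n : ℕ) : linPoly f n ^ 2 = linPoly (tauMul f) (n + 1) := by
  rw [linPoly, linPoly, Finset.sum_range_succ', ← frobenius_def 2 (Finset.sum _ _), map_sum]
  simp only [tauMul, C_0, zero_mul, add_zero, frobenius_def]
  refine Finset.sum_congr rfl fun i _ => ?_
  rw [C_pow]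
  ring

theorem linPoly_comp_X_add_C (f : ℕ → R) (n : ℕ) (g : R) :
    (linPoly f n).comp (X + C g) = linPoly f n + C ((linPoly f n).eval g) := by
  simp only [linPoly, Polynomial.comp, eval₂_finsetSum, eval_finsetSum, map_sum,
    ← Finset.sum_add_distrib]
  refine Finset.sum_congr rfl fun i _ => ?_
  simp [add_pow_char_pow, mul_add]

end Linearized

theorem ePoly_succ (k : ℕ) (hk : 2 ≤ k) : (Alt (k + 1)).card = 2 * (Alt k).card ∧
    ∃ g : K, ePoly (k + 1) = ePoly k * (ePoly k).comp (X + C g) := by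
  classical
  obtain ⟨g, hd, hu⟩ := exists_Alt_succ k hk
  have hinj : Function.Injective (g + · : A → A) := add_right_injective g
  refine ⟨?_, algebraMap A K g, ?_⟩
  · rw [hu, Finset.card_union_of_disjoint hd, Finset.card_image_of_injective _ hinj, two_mul]
  · rw [ePoly, hu, Finset.prod_union hd, Finset.prod_image fun a _ b _ h => hinj h]
    simp only [ePoly, prod_comp, add_comp, X_comp, C_comp, map_add, add_assoc]

theorem ePoly_eq_linPoly (m : ℕ) : (Alt (m + 2)).card = 2 ^ (m + 1) ∧
    ∃ f : ℕ → K, f (m + 1) = 1 ∧ (∀ i, m + 2 ≤ i → f i = 0) ∧ ePoly (m + 2) = linPoly f (m + 2) := by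
  induction m with
  | zero =>
    classical
    refine ⟨?_, fun i => if i < 2 then 1 else 0, by simp,
      fun i hi => if_neg (by omega), ?_⟩
    · rw [zero_add, Alt_two, Finset.card_pair zero_ne_one, zero_add, pow_one]
    · rw [ePoly, zero_add, Alt_two, Finset.prod_pair zero_ne_one]
      simp [linPoly, Finset.sum_range_succ]
      ring
  | succ m ih =>
    obtain ⟨hc, f, hf1, hf0, he⟩ := ih
    obtain ⟨hc', g, hg⟩ := ePoly_succ (m + 2) (by omega)
    refine ⟨by rw [show m + 1 + 2 = m + 2 + 1 by ring, hc', hc]; ring, ?_⟩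
    -- Additivity turns $e_k(w)e_k(w+g)$ into $e_k(w)^2+e_k(g)e_k(w)$.
    refine ⟨tauMul f + (linPoly f (m + 2)).eval g • f, ?_, fun i hi => ?_, ?_⟩
    · simp [tauMul, hf1, hf0 (m + 2) le_rfl]
    · obtain ⟨i, rfl⟩ : ∃ l, i = l + 1 := ⟨i - 1, by omega⟩
      simp [tauMul, hf0 i (by omega), hf0 (i + 1) (by omega)]
    · rw [show m + 1 + 2 = m + 2 + 1 by ring, hg, he, linPoly_comp_X_add_C, linPoly_add,
        linPoly_smul, ← linPoly_sq, linPoly_succ_of_eq_zero (hf0 (m + 2) le_rfl)]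
      ring

/-! ### Vanishing of $p_k$ on $A_{<k}$ -/

section Vanishing

theorem tauMul_eq_zero {R : Type*} [CommRing R] {a : ℕ → R} {m : ℕ} (h : ∀ k, m < k → a k = 0) :
    ∀ k, m + 1 < k → tauMul a k = 0
  | 0, hk => by omega
  | k + 1, hk => by rw [tauMul, h k (by omega), zero_pow two_ne_zero]

theorem pSeq_xK_mul_eq_zero {w : K} {m : ℕ} (h : ∀ k, m < k → pSeq w k = 0) (k : ℕ)
    (hk : m + 2 < k) : pSeq (xK * w) k = 0 := by
  have h1 := tauMul_eq_zero h
  have h2 := tauMul_eq_zero h1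
  simp [pSeq_xK_mul, h k (by omega), h1 k (by omega), h2 k (by omega)]

theorem pSeq_yK_mul_eq_zero {w : K} {m : ℕ} (h : ∀ k, m < k → pSeq w k = 0) (k : ℕ)
    (hk : m + 3 < k) : pSeq (yK * w) k = 0 := by
  have h1 := tauMul_eq_zero h
  have h2 := tauMul_eq_zero h1
  have h3 := tauMul_eq_zero h2
  simp [pSeq_yK_mul, h k (by omega), h1 k (by omega), h2 k (by omega), h3 k (by omega)]

/-- Each factor $x$ applies $\rho_x$, of degree 2 in $\tau$, starting from $e\circ\log=1$. -/
theorem pSeq_xK_pow (n k : ℕ) (hk : 2 * n < k) : pSeq (xK ^ n) k = 0 := by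
  induction n generalizing k with
  | zero =>
    obtain ⟨k, rfl⟩ : ∃ l, k = l + 1 := ⟨k - 1, by omega⟩
    rw [pow_zero, pSeq_one_succ]
  | succ n ih =>
    rw [pow_succ']
    exact pSeq_xK_mul_eq_zero ih k (by omega)

theorem pSeq_yK_mul_xK_pow (n k : ℕ) (hk : 2 * n + 3 < k) : pSeq (yK * xK ^ n) k = 0 :=
  pSeq_yK_mul_eq_zero (pSeq_xK_pow n) k hk

theorem pSeq_sum {ι : Type*} (s : Finset ι) (w : ι → K) (k : ℕ) :
    pSeq (∑ i ∈ s, w i) k = ∑ i ∈ s, pSeq (w i) k := by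
  rw [← Finset.sum_apply]
  exact congrFun (map_sum (AddMonoidHom.mk' pSeq pSeq_add) w s) k

theorem ofPoly_eq_sum (p : (ZMod 2)[X]) : ofPoly p = ∑ n ∈ p.support, xK ^ n := by
  conv_lhs => rw [p.as_sum_support_C_mul_X_pow]
  rw [map_sum]
  refine Finset.sum_congr rfl fun n hn => ?_
  rw [zmod_two_eq_one (mem_support_iff.mp hn), C_1, one_mul, map_pow, ofPoly_X]

/-- `ρ_a` has degree `deg a` in `τ`. -/
theorem pSeq_eq_zero (a : A) (k : ℕ) (h : deg a < k) : pSeq (algebraMap A K a) k = 0 := by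
  obtain ⟨p, q, rfl⟩ := exists_eq_smul_add_smul a
  obtain ⟨hp, hq⟩ := (deg_lt_iff p q k).mp h
  have ha : algebraMap A K (p • (1 : A) + q • yA) = ofPoly p + yK * ofPoly q := by
    rw [Algebra.smul_def, Algebra.smul_def, mul_one, map_add, map_mul, mul_comm]
    rfl
  rw [ha, ofPoly_eq_sum, ofPoly_eq_sum, Finset.mul_sum, pSeq_add, Pi.add_apply, pSeq_sum, pSeq_sum,
    Finset.sum_eq_zero fun n hn => pSeq_xK_pow n k (hp n (mem_support_iff.mp hn)),
    Finset.sum_eq_zero fun n hn => pSeq_yK_mul_xK_pow n k (hq n (mem_support_iff.mp hn)), add_zero]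

end Vanishing

/-! ### Comparison of $p_k$ with $e_k$ -/

theorem one_div_d (i : ℕ) : 1 / d i = expCoeff i := by
  rw [one_div, d, inv_inv]; rfl

theorem one_div_ell (i : ℕ) : 1 / ell i = logCoeff i := by
  rw [one_div, ell, inv_inv, coeff_logSeries]

theorem d_ne_zero (i : ℕ) : d i ≠ 0 := inv_ne_zero (expCoeff_ne_zero i)

theorem ell_ne_zero (i : ℕ) : ell i ≠ 0 := by
  rw [ell, coeff_logSeries]; exact inv_ne_zero (logCoeff_ne_zero i)

theorem pPoly_eq_linPoly (k : ℕ) :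
    pPoly k = linPoly (fun j => expCoeff j * logCoeff (k - j) ^ 2 ^ j) (k + 1) := by
  refine Finset.sum_congr rfl fun j _ => ?_
  beta_reduce
  rw [← one_div_d, ← one_div_ell, div_pow, one_pow, one_div_mul_one_div]

theorem eval_pPoly (k : ℕ) (w : K) : (pPoly k).eval w = pSeq w k := by
  rw [pPoly_eq_linPoly, linPoly, eval_finsetSum, pSeq, skewMul,
    Finset.Nat.sum_antidiagonal_eq_sum_range_succ
      (fun i j => mulConst expCoeff w i * logCoeff j ^ 2 ^ i)]
  refine Finset.sum_congr rfl fun j _ => ?_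
  simp only [mulConst, eval_mul, eval_C, eval_pow, eval_X]
  ring

theorem eval_ePoly {a : A} {k : ℕ} (h : a ∈ Alt k) : (ePoly k).eval (algebraMap A K a) = 0 := by
  rw [ePoly, eval_prod]
  exact Finset.prod_eq_zero h (by rw [eval_add, eval_X, eval_C, CharTwo.add_self_eq_zero])

theorem ePoly_ne_zero (k : ℕ) : ePoly k ≠ 0 :=
  Finset.prod_ne_zero_iff.mpr fun _ _ => X_add_C_ne_zero _

theorem pPoly_eq (k : ℕ) (hk : 2 ≤ k) :
    pPoly k = C (1 / d k) * ePoly k ^ 2 + C (constC k) * ePoly k := by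
  classical
  obtain ⟨m, rfl⟩ : ∃ m, k = m + 2 := ⟨k - 2, by omega⟩
  obtain ⟨hc, f, hf1, hf0, he⟩ := ePoly_eq_linPoly m
  have hB : B (m + 2) m = f m := by rw [B, he, coeff_linPoly f (by omega)]
  have hC : constC (m + 2) = expCoeff (m + 1) + expCoeff (m + 2) * f m ^ 2 := by
    rw [constC, Nat.add_sub_cancel, hB, show m + 2 - 1 = m + 1 from rfl, ← one_div_d, ← one_div_d]
    ring
  -- The coefficients of $p_k-e_k^2/d_k-Ce_k$, with plus signs since the characteristic is 2.
  set g : ℕ → K := (fun j => expCoeff j * logCoeff (m + 2 - j) ^ 2 ^ j)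
    + (expCoeff (m + 2) • tauMul f + constC (m + 2) • f) with hg
  have hlin : pPoly (m + 2) + (C (1 / d (m + 2)) * ePoly (m + 2) ^ 2
      + C (constC (m + 2)) * ePoly (m + 2)) = linPoly g (m + 3) := by
    rw [hg, linPoly_add, linPoly_add, linPoly_smul, linPoly_smul, ← linPoly_sq,
      linPoly_succ_of_eq_zero (hf0 (m + 2) le_rfl), ← pPoly_eq_linPoly, he, one_div_d]
  have hg2 : g (m + 2) = 0 := by
    simp [hg, tauMul, hf1, hf0 (m + 2) le_rfl, logCoeff, CharTwo.add_self_eq_zero]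
  -- This coefficient is what determines $C$: it is $1/d_{k-1}$ in $p_k$, as $\ell_1=1$, and
  -- $B_{k,k-2}^2/d_k$ in $e_k^2/d_k$, while $e_k$ is monic.
  have hg1 : g (m + 1) = 0 := by
    have h2 : (2 : K) = 0 := CharTwo.two_eq_zero
    simp only [hg, Pi.add_apply, Pi.smul_apply, smul_eq_mul, tauMul, hf1, hC,
      show m + 2 - (m + 1) = 1 by omega, logCoeff, one_pow]
    linear_combination (expCoeff (m + 1) + expCoeff (m + 2) * f m ^ 2) * h2
  rw [linPoly_succ_of_eq_zero hg2, linPoly_succ_of_eq_zero hg1] at hlin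
  rw [← sub_eq_zero, CharTwo.sub_eq_add, hlin]
  -- The degree is at most $2^m$, and there are $2^{m+1}$ roots.
  refine eq_zero_of_natDegree_lt_card_of_eval_eq_zero' _ ((Alt (m + 2)).image (algebraMap A K))
    (fun w hw => ?_) ?_
  · obtain ⟨a, ha, rfl⟩ := Finset.mem_image.mp hw
    rw [← hlin]
    simp [eval_pPoly, pSeq_eq_zero a _ (mem_Alt.mp ha), eval_ePoly ha]
  · rw [Finset.card_image_of_injective _ (IsFractionRing.injective A K), hc]
    exact (natDegree_linPoly_succ_le g m).trans_lt (Nat.pow_lt_pow_right one_lt_two m.lt_succ_self)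

end DrinfeldExample

theorem mainTheorem2 (k : ℕ) (hk : 2 ≤ k) :
    (∀ j : ℕ, DrinfeldExample.d j ≠ 0 ∧ DrinfeldExample.ell j ≠ 0) ∧
    DrinfeldExample.ePoly k ∣ DrinfeldExample.pPoly k ∧
    DrinfeldExample.R k = algebraMap (Polynomial DrinfeldExample.K) (RatFunc DrinfeldExample.K)
      (Polynomial.C (1 / DrinfeldExample.d k) * DrinfeldExample.ePoly k
        + Polynomial.C (DrinfeldExample.constC k)) ∧
    DrinfeldExample.pPoly k =
      Polynomial.C (1 / DrinfeldExample.d k) * DrinfeldExample.ePoly k ^ 2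
        + Polynomial.C (DrinfeldExample.constC k) * DrinfeldExample.ePoly k := by
  have h := DrinfeldExample.pPoly_eq k hk
  have hmul : DrinfeldExample.pPoly k = (Polynomial.C (1 / DrinfeldExample.d k)
      * DrinfeldExample.ePoly k + Polynomial.C (DrinfeldExample.constC k))
      * DrinfeldExample.ePoly k := by
    rw [h]; ring
  refine ⟨fun j => ⟨DrinfeldExample.d_ne_zero j, DrinfeldExample.ell_ne_zero j⟩,
    Dvd.intro_left _ hmul.symm, ?_, h⟩
  rw [DrinfeldExample.R, hmul, map_mul, mul_div_cancel_right₀]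
  exact RatFunc.algebraMap_ne_zero (DrinfeldExample.ePoly_ne_zero k)
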